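/- Let $S$ be a finite set of integers. For $n\ge 0$ let $a_S(n)$ be the number of permutations $\pi$ of $\{1,\dots,n\}$ such that $\pi(i)-i\notin S$ for all $1\le i\le n$, and let $b_S(n)$ be the number of permutations $\pi$ of $\{1,\dots,n\}$ such that, for all $1\le i\le n$, $\pi(i)-i$ is not congruent modulo $n$ to any element of $S$ (with $a_S(0)=b_S(0)=1$). Then both sequences $(a_S(n))_{n\ge0}$ and $(b_S(n))_{n\ge0}$ are P-recursive (holonomic): for each $u\in\{a_S,b_S\}$ there are an integer $d\ge 0$ and polynomials $p_0,\dots,p_d\in\mathbb{Q}[x]$ with $p_d\ne 0$ such that $$p_0(n)\,u(n)+p_1(n)\,u(n+1)+\cdots+p_d(n)\,u(n+d)=0\qquad\text{for all integers } n\ge 0.$$ -/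

import Mathlib

/-- `straightCount S n` is the number `a_S(n)` of permutations `π` of `{1, …, n}` with
`π(i) - i ∉ S` for all `i`. (`Fin n` is `{0, …, n - 1}`; the shift by one does not change the
differences `π(i) - i`, which are taken in `ℤ`.) -/
def straightCount (S : Finset ℤ) (n : ℕ) : ℕ :=
  (Finset.univ.filter fun π : Equiv.Perm (Fin n) =>
    ∀ i : Fin n, ((π i : ℕ) : ℤ) - ((i : ℕ) : ℤ) ∉ S).card

/-- `circularCount S n` is the number `b_S(n)` of permutations `π` of `{1, …, n}`, arranged
around a circle so that `1` comes after `n`, such that `π(i) - i` is not congruent modulo `n`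
to any member of `S`, for all `i`. -/
def circularCount (S : Finset ℤ) (n : ℕ) : ℕ :=
  (Finset.univ.filter fun π : Equiv.Perm (Fin n) =>
    ∀ i : Fin n, ∀ s ∈ S, ¬ (((π i : ℕ) : ℤ) - ((i : ℕ) : ℤ) ≡ s [ZMOD (n : ℤ)])).card

/-- A sequence `u` of rational numbers is P-recursive (holonomic) if it satisfies a homogeneous
linear recurrence `p₀(n) u(n) + p₁(n) u(n+1) + ⋯ + p_d(n) u(n+d) = 0`, valid for all `n ≥ 0`,
whose coefficients are polynomials in `n` and whose leading coefficient `p_d` is not the zero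
polynomial. -/
def IsPRecursive (u : ℕ → ℚ) : Prop :=
  ∃ (d : ℕ) (p : ℕ → Polynomial ℚ), p d ≠ 0 ∧
    ∀ n : ℕ, ∑ j ∈ Finset.range (d + 1), (p j).eval (n : ℚ) * u (n + j) = 0

/-! ### Integration against `e^{-t}`, and pole orders of derivatives of a rational function -/

section Holonomy

open Polynomial Finset

/-! Inclusion–exclusion over rooks on forbidden cells gives `u(n) = L(P_n)`, where `L(t^k) = k!` and
`P_n(t)` sums `(-1)^j t^(n-j)` over placements of `j` non-attacking rooks (`card_perm_avoiding`).
The forbidden cells lie in a band, apart from boundary effects, so a transfer matrix on occupied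
windows makes `F = ∑ P_n z^n` rational in `z` and `t` (`isRationalSeq_placementPoly`).

It remains to show that `∫ F e^{-t} dt` is holonomic in `z` (`IsRationalSeq.isPRecursive`). This is
creative telescoping. With `θ = z d/dz` and `δ = ∂_t - 1`, the operators `z^a θ^b δ^c` with
exponents below `m` number `m^3`, while their values at `F`, over a common denominator, lie in a
space of dimension `O(m^2)`; hence some nonzero combination kills `F`. None of these operators
multiplies by `t`, so a power of `δ` can be split off, leaving `Q(z, θ) F + δ G = 0` with `Q ≠ 0`.
Integration by parts turns this into `Q U = G|_{t=0}` for the generating function `U` of `u`. The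
right side is rational in `z`; clearing its denominator gives the recurrence for large `n`. -/

/-- The linear functional `t ^ k ↦ k!`, that is, `p ↦ ∫₀^∞ p(t) e^{-t} dt`. -/
noncomputable def factorialFunctional : ℚ[X] →ₗ[ℚ] ℚ :=
  Polynomial.lsum fun k => (k.factorial : ℚ) • LinearMap.id

theorem factorialFunctional_monomial (k : ℕ) (a : ℚ) :
    factorialFunctional (monomial k a) = k.factorial * a := by
  simp [factorialFunctional, Polynomial.lsum_apply, Polynomial.sum_monomial_index]

theorem factorialFunctional_X_pow (k : ℕ) :
    factorialFunctional (X ^ k) = k.factorial := by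
  rw [X_pow_eq_monomial, factorialFunctional_monomial, mul_one]

/-- The operator `p ↦ p' - p` on polynomials. -/
noncomputable def derivSub : ℚ[X] →ₗ[ℚ] ℚ[X] := Polynomial.derivative - LinearMap.id

theorem derivSub_apply (p : ℚ[X]) : derivSub p = derivative p - p := rfl

/-- Integration by parts: `(p' - p) e^{-t}` is the derivative of `p e^{-t}`. -/
theorem factorialFunctional_derivSub (p : ℚ[X]) :
    factorialFunctional (derivSub p) = -p.eval 0 := by
  rw [derivSub_apply]
  induction p using Polynomial.induction_on' with
  | add p q hp hq =>
    have : derivative (p + q) - (p + q) = (derivative p - p) + (derivative q - q) := by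
      rw [derivative_add]; ring
    rw [this, map_add, hp, hq, eval_add]; ring
  | monomial k a =>
    rw [map_sub, derivative_monomial, factorialFunctional_monomial, factorialFunctional_monomial]
    cases k with
    | zero => simp
    | succ k => simp [Nat.factorial_succ]; ring

theorem derivSub_eq_zero {p : ℚ[X]} (h : derivSub p = 0) : p = 0 := by
  rw [derivSub_apply, sub_eq_zero] at h
  by_contra hp
  have h1 := degree_derivative_lt hp
  rw [h] at h1
  exact lt_irrefl _ h1

/-- Apply a linear map to all coefficients of a power series. -/
noncomputable def mapCoeff {A B : Type*} [CommRing A] [Algebra ℚ A] [CommRing B] [Algebra ℚ B]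
    (f : A →ₗ[ℚ] B) : PowerSeries A →ₗ[ℚ] PowerSeries B where
  toFun F := PowerSeries.mk fun n => f (PowerSeries.coeff n F)
  map_add' F G := by ext n; simp
  map_smul' r F := by ext n; simp [PowerSeries.coeff_mk]

@[simp]
theorem coeff_mapCoeff {A B : Type*} [CommRing A] [Algebra ℚ A] [CommRing B] [Algebra ℚ B]
    (f : A →ₗ[ℚ] B) (F : PowerSeries A) (n : ℕ) :
    PowerSeries.coeff n (mapCoeff f F) = f (PowerSeries.coeff n F) := by
  simp [mapCoeff]

/-- The Euler operator `z d/dz` on power series. -/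
noncomputable def eulerOp (A : Type*) [CommRing A] [Algebra ℚ A] :
    PowerSeries A →ₗ[ℚ] PowerSeries A where
  toFun F := PowerSeries.mk fun n => (n : ℚ) • PowerSeries.coeff n F
  map_add' F G := by ext n; simp
  map_smul' r F := by ext n; simpa [PowerSeries.coeff_mk] using smul_comm _ _ _

@[simp]
theorem coeff_eulerOp {A : Type*} [CommRing A] [Algebra ℚ A] (F : PowerSeries A) (n : ℕ) :
    PowerSeries.coeff n (eulerOp A F) = (n : ℚ) • PowerSeries.coeff n F := by
  simp [eulerOp]

theorem coeff_eulerOp_iterate {A : Type*} [CommRing A] [Algebra ℚ A] (F : PowerSeries A)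
    (n b : ℕ) :
    PowerSeries.coeff n ((eulerOp A)^[b] F) = (n : ℚ) ^ b • PowerSeries.coeff n F := by
  induction b with
  | zero => simp
  | succ b ih => rw [Function.iterate_succ_apply', coeff_eulerOp, ih, smul_smul, pow_succ']

theorem eulerOp_mul {A : Type*} [CommRing A] [Algebra ℚ A] (F G : PowerSeries A) :
    eulerOp A (F * G) = eulerOp A F * G + F * eulerOp A G := by
  ext n
  rw [coeff_eulerOp, map_add, PowerSeries.coeff_mul, PowerSeries.coeff_mul,
    PowerSeries.coeff_mul, ← sum_add_distrib, smul_sum]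
  refine sum_congr rfl fun p hp => ?_
  rw [HasAntidiagonal.mem_antidiagonal] at hp
  rw [coeff_eulerOp, coeff_eulerOp, ← hp, smul_mul_assoc, mul_smul_comm, ← add_smul]
  push_cast
  rfl

theorem mapCoeff_derivative_mul (F G : PowerSeries ℚ[X]) :
    mapCoeff derivative (F * G) =
      mapCoeff derivative F * G + F * mapCoeff derivative G := by
  ext1 n
  rw [coeff_mapCoeff, map_add, PowerSeries.coeff_mul, PowerSeries.coeff_mul,
    PowerSeries.coeff_mul, ← sum_add_distrib, map_sum]
  refine sum_congr rfl fun p _ => ?_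
  rw [coeff_mapCoeff, coeff_mapCoeff, derivative_mul]

/-- The operator `F ↦ ∂F/∂t - F` on power series in `z` with coefficients in `ℚ[t]`. -/
noncomputable def derivSubOp : PowerSeries ℚ[X] →ₗ[ℚ] PowerSeries ℚ[X] := mapCoeff derivSub

theorem derivSubOp_eq (F : PowerSeries ℚ[X]) :
    derivSubOp F = mapCoeff derivative F - F := by
  ext1 n
  simp [derivSubOp, derivSub_apply]

theorem derivSubOp_eq_zero {F : PowerSeries ℚ[X]} (h : derivSubOp F = 0) : F = 0 := by
  ext1 n
  have := congrArg (PowerSeries.coeff n) h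
  rw [derivSubOp, coeff_mapCoeff, map_zero] at this
  rw [derivSub_eq_zero this, map_zero]

/-- Power series that are polynomials of degree at most `K` in each of the two variables. -/
def boxSubmodule (K : ℕ) : Submodule ℚ (PowerSeries ℚ[X]) where
  carrier := {F | ∀ i j, K < i ∨ K < j → (PowerSeries.coeff i F).coeff j = 0}
  add_mem' {F G} hF hG i j h := by rw [map_add, coeff_add, hF i j h, hG i j h, add_zero]
  zero_mem' i j _ := by simp
  smul_mem' r F hF i j h := by
    have := hF i j h
    simp [this]

theorem boxSubmodule_mono {K K' : ℕ} (h : K ≤ K') : boxSubmodule K ≤ boxSubmodule K' :=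
  fun _ hF i j hij => hF i j (by omega)

theorem mul_mem_boxSubmodule {K K' : ℕ} {F G : PowerSeries ℚ[X]} (hF : F ∈ boxSubmodule K)
    (hG : G ∈ boxSubmodule K') : F * G ∈ boxSubmodule (K + K') := by
  intro i j hij
  rw [PowerSeries.coeff_mul, finsetSum_coeff]
  refine sum_eq_zero fun p hp => ?_
  rw [Polynomial.coeff_mul]
  refine sum_eq_zero fun q hq => ?_
  rw [HasAntidiagonal.mem_antidiagonal] at hp hq
  by_cases h : K < p.1 ∨ K < q.1
  · rw [hF _ _ h, zero_mul]
  · rw [hG _ _ (by omega), mul_zero]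

theorem pow_mem_boxSubmodule {K : ℕ} {F : PowerSeries ℚ[X]} (hF : F ∈ boxSubmodule K) (n : ℕ) :
    F ^ n ∈ boxSubmodule (n * K) := by
  induction n with
  | zero =>
    intro i j hij
    rw [pow_zero, PowerSeries.coeff_one]
    split_ifs with h
    · rw [coeff_one, if_neg (by omega)]
    · simp
  | succ n ih => rw [pow_succ, Nat.succ_mul]; exact mul_mem_boxSubmodule ih hF

theorem X_pow_mem_boxSubmodule (a : ℕ) : (PowerSeries.X ^ a : PowerSeries ℚ[X]) ∈ boxSubmodule a := by
  intro i j hij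
  rw [PowerSeries.coeff_X_pow]
  split_ifs with h
  · rw [coeff_one, if_neg (by omega)]
  · simp

theorem eulerOp_mem_boxSubmodule {K : ℕ} {F : PowerSeries ℚ[X]} (hF : F ∈ boxSubmodule K) :
    eulerOp _ F ∈ boxSubmodule K := by
  intro i j hij
  rw [coeff_eulerOp, coeff_smul, hF i j hij, smul_zero]

theorem mapCoeff_derivative_mem_boxSubmodule {K : ℕ} {F : PowerSeries ℚ[X]}
    (hF : F ∈ boxSubmodule K) : mapCoeff derivative F ∈ boxSubmodule K := by
  intro i j hij
  rw [coeff_mapCoeff, coeff_derivative, hF i (j + 1) (by omega), zero_mul]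

theorem coe_mem_boxSubmodule (D : ℚ[X][X]) : ∃ d, (D : PowerSeries ℚ[X]) ∈ boxSubmodule d := by
  refine ⟨D.natDegree + D.support.sup fun i => (D.coeff i).natDegree, fun i j hij => ?_⟩
  rw [Polynomial.coeff_coe]
  by_cases hi : i ∈ D.support
  · have h1 := le_natDegree_of_mem_supp i hi
    have h2 : (D.coeff i).natDegree ≤ _ := le_sup (f := fun i => (D.coeff i).natDegree) hi
    exact coeff_eq_zero_of_natDegree_lt (by omega)
  · rw [notMem_support_iff.mp hi, coeff_zero]

/-- A derivation-like operator raises the pole order along `D` by at most one. -/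
theorem pow_succ_mul_mem_boxSubmodule {T : PowerSeries ℚ[X] → PowerSeries ℚ[X]}
    (hT : ∀ F G, T (F * G) = T F * G + F * T G)
    (hbox : ∀ K, ∀ F ∈ boxSubmodule K, T F ∈ boxSubmodule K)
    {D : PowerSeries ℚ[X]} {d : ℕ} (hD : D ∈ boxSubmodule d) {j K : ℕ} {G : PowerSeries ℚ[X]}
    (hG : D ^ j * G ∈ boxSubmodule K) : D ^ (j + 1) * T G ∈ boxSubmodule (K + d) := by
  have key : ∀ j : ℕ, D * T (D ^ j) = j * D ^ j * T D := by
    intro j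
    induction j with
    | zero =>
      have h1 := hT 1 1
      simp only [mul_one, one_mul] at h1
      have : T 1 = 0 := by simpa using h1
      simp [this]
    | succ j ih =>
      rw [pow_succ, hT]
      push_cast
      linear_combination D * ih
  -- The quotient rule for `G = (D ^ j * G) / D ^ j`, with denominators cleared.
  have e : D ^ (j + 1) * T G = T (D ^ j * G) * D - ((j : ℚ) • (D ^ j * G)) * T D := by
    rw [hT]
    have : (j : ℚ) • (D ^ j * G) = (j : PowerSeries ℚ[X]) * (D ^ j * G) := by
      rw [← nsmul_eq_mul, Nat.cast_smul_eq_nsmul]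
    rw [this]
    linear_combination -G * key j
  rw [e]
  exact Submodule.sub_mem _ (mul_mem_boxSubmodule (hbox _ _ hG) hD)
    (mul_mem_boxSubmodule (Submodule.smul_mem _ _ hG) (hbox _ _ hD))

theorem pow_succ_mul_eulerOp_mem {D : PowerSeries ℚ[X]} {d : ℕ} (hD : D ∈ boxSubmodule d)
    {j K : ℕ} {G : PowerSeries ℚ[X]} (hG : D ^ j * G ∈ boxSubmodule K) :
    D ^ (j + 1) * eulerOp _ G ∈ boxSubmodule (K + d) :=
  pow_succ_mul_mem_boxSubmodule eulerOp_mul (fun _ _ => eulerOp_mem_boxSubmodule) hD hG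

theorem pow_succ_mul_derivSubOp_mem {D : PowerSeries ℚ[X]} {d : ℕ} (hD : D ∈ boxSubmodule d)
    {j K : ℕ} {G : PowerSeries ℚ[X]} (hG : D ^ j * G ∈ boxSubmodule K) :
    D ^ (j + 1) * derivSubOp G ∈ boxSubmodule (K + d) := by
  rw [derivSubOp_eq, mul_sub]
  refine Submodule.sub_mem _ (pow_succ_mul_mem_boxSubmodule mapCoeff_derivative_mul
    (fun _ _ => mapCoeff_derivative_mem_boxSubmodule) hD hG) ?_
  rw [pow_succ', mul_assoc, add_comm]
  exact mul_mem_boxSubmodule hD hG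

theorem iterate_mem_boxSubmodule {D F : PowerSeries ℚ[X]} {d : ℕ} (hD : D ∈ boxSubmodule d)
    (hF : D * F ∈ boxSubmodule d) (b c : ℕ) :
    D ^ (b + c + 1) * (eulerOp _)^[b] (derivSubOp^[c] F) ∈ boxSubmodule ((b + c + 1) * d) := by
  induction b with
  | zero =>
    induction c with
    | zero => simpa using hF
    | succ c ih =>
      have := pow_succ_mul_derivSubOp_mem hD ih
      simp only [Function.iterate_zero, id_eq] at this ⊢
      rw [Function.iterate_succ_apply']
      convert this using 2 <;> ring
  | succ b ih =>
    have := pow_succ_mul_eulerOp_mem hD ih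
    rw [Function.iterate_succ_apply']
    convert this using 2
    · ring
    · ring

/-- One denominator `D ^ (2 * m)` serves all the operators, since `b + c + 1 < 2 * m`. The degree
bound is linear in `m`, which the dimension count needs. -/
theorem weyl_mem_boxSubmodule {D F : PowerSeries ℚ[X]} {d : ℕ} (hD : D ∈ boxSubmodule d)
    (hF : D * F ∈ boxSubmodule d) {m a b c : ℕ} (ha : a < m) (hb : b < m) (hc : c < m) :
    D ^ (2 * m) * (PowerSeries.X ^ a * (eulerOp _)^[b] (derivSubOp^[c] F)) ∈
      boxSubmodule (2 * m * d + m) := by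
  obtain ⟨e, he⟩ : ∃ e, 2 * m = e + (b + c + 1) := ⟨2 * m - (b + c + 1), by omega⟩
  have h := mul_mem_boxSubmodule (X_pow_mem_boxSubmodule a)
    (mul_mem_boxSubmodule (pow_mem_boxSubmodule hD e) (iterate_mem_boxSubmodule hD hF b c))
  have e1 : D ^ (2 * m) * (PowerSeries.X ^ a * (eulerOp _)^[b] (derivSubOp^[c] F)) =
      PowerSeries.X ^ a * (D ^ e * (D ^ (b + c + 1) * (eulerOp _)^[b] (derivSubOp^[c] F))) := by
    rw [he, pow_add]; ring
  rw [e1]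
  refine boxSubmodule_mono ?_ h
  rw [he, ← add_mul]
  omega

end Holonomy

/-! ### Operators in `z` and `θ`; creative telescoping -/

section HolonomyWeyl

open Polynomial Finset

/-- The action of the operator `∑ k, z ^ k * Q_k(θ)`, with `θ = z d/dz`, on power series in `z`;
here `Q_k` is the `k`-th coefficient of `Q`. -/
noncomputable def weylOp {A : Type*} [CommRing A] [Algebra ℚ A] (Q : ℚ[X][X]) (F : PowerSeries A) :
    PowerSeries A :=
  PowerSeries.mk fun n => ∑ p ∈ antidiagonal n,
    (Q.coeff p.1).eval (p.2 : ℚ) • PowerSeries.coeff p.2 F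

theorem coeff_weylOp {A : Type*} [CommRing A] [Algebra ℚ A] (Q : ℚ[X][X]) (F : PowerSeries A)
    (n : ℕ) : PowerSeries.coeff n (weylOp Q F) = ∑ p ∈ antidiagonal n,
      (Q.coeff p.1).eval (p.2 : ℚ) • PowerSeries.coeff p.2 F := by
  simp [weylOp]

/-- Operators in `z` commute with everything done to the coefficients: this covers both `δ` and
integration over `t`. -/
theorem mapCoeff_weylOp {A B : Type*} [CommRing A] [Algebra ℚ A] [CommRing B] [Algebra ℚ B]
    (f : A →ₗ[ℚ] B) (Q : ℚ[X][X]) (F : PowerSeries A) :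
    mapCoeff f (weylOp Q F) = weylOp Q (mapCoeff f F) := by
  ext n
  simp [coeff_weylOp]

theorem weylOp_zero {A : Type*} [CommRing A] [Algebra ℚ A] (F : PowerSeries A) :
    weylOp 0 F = 0 := by
  ext n
  simp [coeff_weylOp]

theorem weylOp_add {A : Type*} [CommRing A] [Algebra ℚ A] (P Q : ℚ[X][X]) (F : PowerSeries A) :
    weylOp (P + Q) F = weylOp P F + weylOp Q F := by
  ext n
  simp [coeff_weylOp, add_smul, sum_add_distrib]

theorem weylOp_sum {A : Type*} [CommRing A] [Algebra ℚ A] {ι : Type*} (s : Finset ι)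
    (Q : ι → ℚ[X][X]) (F : PowerSeries A) :
    weylOp (∑ i ∈ s, Q i) F = ∑ i ∈ s, weylOp (Q i) F := by
  classical
  induction s using Finset.induction_on with
  | empty => simp [weylOp_zero]
  | insert a s ha ih => rw [sum_insert ha, sum_insert ha, weylOp_add, ih]

theorem weylOp_monomial {A : Type*} [CommRing A] [Algebra ℚ A] (a b : ℕ) (r : ℚ)
    (F : PowerSeries A) :
    weylOp (monomial a (monomial b r)) F = r • (PowerSeries.X ^ a * (eulerOp A)^[b] F) := by
  ext n
  rw [coeff_weylOp, PowerSeries.coeff_smul, PowerSeries.coeff_X_pow_mul']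
  split_ifs with h
  · rw [sum_eq_single (a, n - a)]
    · rw [coeff_monomial, if_pos rfl, eval_monomial, coeff_eulerOp_iterate, mul_smul]
    · intro p hp hne
      rw [HasAntidiagonal.mem_antidiagonal] at hp
      rw [coeff_monomial, if_neg, eval_zero, zero_smul]
      intro h'
      exact hne (Prod.ext h'.symm (by simp only; omega))
    · intro h'
      exact absurd (HasAntidiagonal.mem_antidiagonal.mpr (by simp only; omega)) h'
  · rw [smul_zero]
    refine sum_eq_zero fun p hp => ?_
    rw [HasAntidiagonal.mem_antidiagonal] at hp
    rw [coeff_monomial, if_neg (by omega), eval_zero, zero_smul]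

theorem coe_mul_weylOp (E : ℚ[X]) (Q : ℚ[X][X]) (U : PowerSeries ℚ) :
    (E : PowerSeries ℚ) * weylOp Q U = weylOp (E.map C * Q) U := by
  ext n
  rw [PowerSeries.coeff_mul, coeff_weylOp]
  simp_rw [coeff_weylOp, Polynomial.coeff_mul, eval_finsetSum, sum_smul, mul_sum, sum_sigma']
  refine sum_nbij' (fun x => ⟨(x.1.1 + x.2.1, x.2.2), (x.1.1, x.2.1)⟩)
    (fun x => ⟨(x.2.1, x.2.2 + x.1.2), (x.2.2, x.1.2)⟩) ?_ ?_ ?_ ?_ ?_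
  · rintro ⟨⟨a, b⟩, ⟨c, d⟩⟩ h
    simp only [mem_sigma, HasAntidiagonal.mem_antidiagonal, and_true] at h ⊢
    omega
  · rintro ⟨⟨a, b⟩, ⟨c, d⟩⟩ h
    simp only [mem_sigma, HasAntidiagonal.mem_antidiagonal, and_true] at h ⊢
    omega
  · rintro ⟨⟨a, b⟩, ⟨c, d⟩⟩ h
    simp only [mem_sigma, HasAntidiagonal.mem_antidiagonal] at h
    obtain ⟨_, rfl⟩ := h
    rfl
  · rintro ⟨⟨a, b⟩, ⟨c, d⟩⟩ h
    simp only [mem_sigma, HasAntidiagonal.mem_antidiagonal] at h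
    obtain ⟨_, rfl⟩ := h
    rfl
  · rintro ⟨⟨a, b⟩, ⟨c, d⟩⟩ h
    simp only [Polynomial.coeff_coe, coeff_map, eval_mul, eval_C, smul_eq_mul]
    ring

theorem exists_annihilator {D F : PowerSeries ℚ[X]} {d : ℕ} (hD0 : D ≠ 0)
    (hD : D ∈ boxSubmodule d) (hF : D * F ∈ boxSubmodule d) :
    ∃ (m : ℕ) (c : Fin m → Fin m → Fin m → ℚ), c ≠ 0 ∧
      ∑ k, ∑ a, ∑ b, c k a b •
        (PowerSeries.X ^ (a : ℕ) * (eulerOp _)^[b] (derivSubOp^[k] F)) = 0 := by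
  -- The box has dimension `(K + 1)^2 ≤ m^2 (2d + 2)^2`, so `m > (2d + 2)^2` makes it smaller than
  -- the `m^3` unknowns.
  set m := (2 * d + 2) ^ 2 + 1 with hm
  set K := 2 * m * d + m with hK
  let Ψ : (Fin m → Fin m → Fin m → ℚ) →ₗ[ℚ] PowerSeries ℚ[X] :=
    { toFun := fun c => ∑ k, ∑ a, ∑ b, c k a b •
        (PowerSeries.X ^ (a : ℕ) * (eulerOp _)^[b] (derivSubOp^[k] F))
      map_add' := fun c c' => by simp [add_smul, sum_add_distrib]
      map_smul' := fun r c => by simp [mul_smul, smul_sum] }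
  let Φ : PowerSeries ℚ[X] →ₗ[ℚ] (Fin (K + 1) → Fin (K + 1) → ℚ) :=
    { toFun := fun G i j => (PowerSeries.coeff i G).coeff j
      map_add' := fun G G' => by ext i j; simp
      map_smul' := fun r G => by ext i j; simp }
  have hΨ : ∀ c, D ^ (2 * m) * Ψ c ∈ boxSubmodule K := by
    intro c
    change D ^ (2 * m) * ∑ k, ∑ a, ∑ b, _ ∈ _
    simp_rw [mul_sum, mul_smul_comm]
    exact Submodule.sum_mem _ fun k _ => Submodule.sum_mem _ fun a _ => Submodule.sum_mem _
      fun b _ => Submodule.smul_mem _ _ (weyl_mem_boxSubmodule hD hF a.2 b.2 k.2)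
  have hlt : Module.finrank ℚ (Fin (K + 1) → Fin (K + 1) → ℚ) <
      Module.finrank ℚ (Fin m → Fin m → Fin m → ℚ) := by
    simp only [Module.finrank_pi_fintype, Module.finrank_self, sum_const, card_univ,
      Fintype.card_fin, smul_eq_mul, mul_one]
    have h1 : K + 1 ≤ m * (2 * d + 2) := by
      rw [hK]; nlinarith
    calc (K + 1) * (K + 1) ≤ (m * (2 * d + 2)) * (m * (2 * d + 2)) := Nat.mul_le_mul h1 h1
      _ = m * m * (2 * d + 2) ^ 2 := by ring
      _ < m * m * m := by
        refine Nat.mul_lt_mul_of_pos_left ?_ ?_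
        · omega
        · positivity
      _ = _ := by ring
  have hker := LinearMap.ker_ne_bot_of_finrank_lt
    (f := Φ ∘ₗ LinearMap.mulLeft ℚ (D ^ (2 * m)) ∘ₗ Ψ) hlt
  obtain ⟨c, hc, hc0⟩ := Submodule.exists_mem_ne_zero_of_ne_bot hker
  refine ⟨m, c, hc0, ?_⟩
  rw [LinearMap.mem_ker] at hc
  have hz : D ^ (2 * m) * Ψ c = 0 := by
    ext i j
    rw [map_zero, coeff_zero]
    by_cases hij : K < i ∨ K < j
    · exact hΨ c i j hij
    · have := congrFun (congrFun hc ⟨i, by omega⟩) ⟨j, by omega⟩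
      exact this
  exact (mul_eq_zero.mp hz).resolve_left (pow_ne_zero _ hD0)

theorem derivSubOp_weylOp (Q : ℚ[X][X]) (F : PowerSeries ℚ[X]) :
    derivSubOp (weylOp Q F) = weylOp Q (derivSubOp F) :=
  mapCoeff_weylOp _ _ _

theorem derivSubOp_iterate_eq_zero {F : PowerSeries ℚ[X]} {k : ℕ} (h : derivSubOp^[k] F = 0) :
    F = 0 := by
  induction k with
  | zero => exact h
  | succ k ih =>
    rw [Function.iterate_succ_apply'] at h
    exact ih (derivSubOp_eq_zero h)

theorem derivSubOp_iterate_weylOp (Q : ℚ[X][X]) (F : PowerSeries ℚ[X]) (k : ℕ) :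
    derivSubOp^[k] (weylOp Q F) = weylOp Q (derivSubOp^[k] F) := by
  induction k with
  | zero => rfl
  | succ k ih =>
    rw [Function.iterate_succ_apply', ih, derivSubOp_weylOp, Function.iterate_succ_apply']

theorem exists_derivSubOp_relation {D F : PowerSeries ℚ[X]} {d : ℕ} (hD0 : D ≠ 0)
    (hD : D ∈ boxSubmodule d) (hF : D * F ∈ boxSubmodule d) :
    ∃ (Q : ℚ[X][X]) (G : PowerSeries ℚ[X]) (M K : ℕ), Q ≠ 0 ∧
      weylOp Q F + derivSubOp G = 0 ∧ D ^ M * G ∈ boxSubmodule K := by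
  obtain ⟨m, c, hc, h⟩ := exists_annihilator hD0 hD hF
  let c' : ℕ → Fin m → Fin m → ℚ := fun k => if hk : k < m then c ⟨k, hk⟩ else 0
  let Q : ℕ → ℚ[X][X] := fun k =>
    ∑ a : Fin m, ∑ b : Fin m, monomial (a : ℕ) (monomial (b : ℕ) (c' k a b))
  have hQop : ∀ (k : ℕ) (G : PowerSeries ℚ[X]), weylOp (Q k) G = ∑ a : Fin m, ∑ b : Fin m,
      c' k a b • (PowerSeries.X ^ (a : ℕ) * (eulerOp _)^[b] G) := by
    intro k G
    simp only [Q, weylOp_sum, weylOp_monomial]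
  have hQcoeff : ∀ k (a b : Fin m), ((Q k).coeff a).coeff b = c' k a b := by
    intro k a b
    simp only [Q, finsetSum_coeff, coeff_monomial]
    rw [sum_eq_single a, sum_eq_single b]
    · simp
    · intro b' _ hb
      simp [coeff_monomial, Fin.val_inj, hb]
    · simp
    · intro a' _ ha
      simp [Fin.val_inj, ha]
    · simp
  have hQm : ∀ k, m ≤ k → Q k = 0 := by
    intro k hk
    simp [Q, c', Nat.not_lt.mpr hk]
  have hex : ∃ k, Q k ≠ 0 := by
    by_contra hno
    push Not at hno
    refine hc (funext fun k => funext fun a => funext fun b => ?_)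
    have := hQcoeff k a b
    rw [hno] at this
    simpa [c'] using this.symm
  classical
  -- The lowest power of `δ` that occurs. Since `δ` commutes with the `Q k` and is injective, `δ^k₀`
  -- can be cancelled; the surviving term free of `δ` is `Q k₀ ≠ 0`.
  set k₀ := Nat.find hex with hk₀
  have hk₀Q : Q k₀ ≠ 0 := Nat.find_spec hex
  have hmin : ∀ k < k₀, Q k = 0 := fun k hk => not_not.mp (Nat.find_min hex hk)
  have hk₀m : k₀ < m := by
    by_contra hge
    exact hk₀Q (hQm _ (not_lt.mp hge))
  obtain ⟨r, hr⟩ : ∃ r, m = k₀ + (r + 1) := ⟨m - k₀ - 1, by omega⟩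
  have hsum : ∑ k ∈ range m, weylOp (Q k) (derivSubOp^[k] F) = 0 := by
    rw [← Fin.sum_univ_eq_sum_range (fun k => weylOp (Q k) (derivSubOp^[k] F)), ← h]
    refine sum_congr rfl fun k _ => ?_
    rw [hQop]
    simp [c']
  rw [hr, sum_range_add, sum_eq_zero (fun k hk => by
    rw [hmin k (mem_range.mp hk), weylOp_zero]), zero_add] at hsum
  have hsum' : ∑ j ∈ range (r + 1), weylOp (Q (k₀ + j)) (derivSubOp^[j] F) = 0 := by
    apply derivSubOp_iterate_eq_zero (k := k₀)
    rw [← Module.End.pow_apply, map_sum, ← hsum]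
    refine sum_congr rfl fun j _ => ?_
    rw [Module.End.pow_apply, derivSubOp_iterate_weylOp, Function.iterate_add_apply]
  refine ⟨Q k₀, ∑ j ∈ range r, weylOp (Q (k₀ + (j + 1))) (derivSubOp^[j] F), 2 * m,
    2 * m * d + m, hk₀Q, ?_, ?_⟩
  · rw [sum_range_succ'] at hsum'
    rw [map_sum, ← hsum', add_comm]
    congr 1
    refine sum_congr rfl fun j _ => ?_
    rw [derivSubOp_weylOp, Function.iterate_succ_apply']
  · rw [mul_sum]
    refine Submodule.sum_mem _ fun j hj => ?_
    rw [hQop]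
    simp_rw [mul_sum, mul_smul_comm]
    rw [mem_range] at hj
    exact Submodule.sum_mem _ fun a _ => Submodule.sum_mem _
      fun b _ => Submodule.smul_mem _ _ (weyl_mem_boxSubmodule hD hF a.2 b.2 (by omega))

end HolonomyWeyl

/-! ### From operators to recurrences; rational generating functions -/

section HolonomyMain

open Polynomial Finset

/-- Multiplying the recurrence by `∏ (x - i)` over `i < n₀` makes it trivial at the exceptional `n`.
-/
theorem IsPRecursive.of_eventually {u : ℕ → ℚ} {d : ℕ} {p : ℕ → ℚ[X]} (hp : p d ≠ 0) {n₀ : ℕ}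
    (h : ∀ n ≥ n₀, ∑ j ∈ range (d + 1), (p j).eval (n : ℚ) * u (n + j) = 0) :
    IsPRecursive u := by
  refine ⟨d, fun j => (∏ i ∈ range n₀, (X - C (i : ℚ))) * p j, ?_, fun n => ?_⟩
  · exact mul_ne_zero (prod_ne_zero_iff.mpr fun i _ => X_sub_C_ne_zero _) hp
  · simp_rw [eval_mul, mul_assoc, ← mul_sum]
    rcases lt_or_ge n n₀ with hn | hn
    · rw [eval_prod, prod_eq_zero (mem_range.mpr hn), zero_mul]
      simp
    · rw [h n hn, mul_zero]

theorem IsPRecursive.of_shift {u : ℕ → ℚ} (m : ℕ) (h : IsPRecursive fun n => u (n + m)) :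
    IsPRecursive u := by
  obtain ⟨d, p, hp, hr⟩ := h
  refine IsPRecursive.of_eventually (d := d) (p := fun j => (p j).comp (X - C (m : ℚ)))
    (n₀ := m) ?_ fun n hn => ?_
  · intro h0
    refine hp ?_
    have := congrArg (fun q : ℚ[X] => q.comp (X + C (m : ℚ))) h0
    simpa [comp_assoc] using this
  · obtain ⟨k, rfl⟩ := Nat.exists_eq_add_of_le' hn
    rw [← hr k]
    refine sum_congr rfl fun j _ => ?_
    have e : k + j + m = k + m + j := by ring
    simp [e]

theorem IsPRecursive.of_weylOp {u : ℕ → ℚ} {Q : ℚ[X][X]} (hQ : Q ≠ 0) {n₀ : ℕ}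
    (h : ∀ n ≥ n₀, PowerSeries.coeff n (weylOp Q (PowerSeries.mk u)) = 0) : IsPRecursive u := by
  have hle := Q.natTrailingDegree_le_natDegree
  -- The coefficient of `z^(n + deg Q)` pairs `u(n + j)` with `Q_{deg Q - j}(n + j)`, so the leading
  -- term comes from the lowest nonzero coefficient of `Q`.
  refine IsPRecursive.of_eventually (d := Q.natDegree - Q.natTrailingDegree)
    (p := fun j => (Q.coeff (Q.natDegree - j)).comp (X + C (j : ℚ))) (n₀ := n₀) ?_ fun n hn => ?_
  · intro h0
    have := congrArg (fun q : ℚ[X] =>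
      q.comp (X - C ((Q.natDegree - Q.natTrailingDegree : ℕ) : ℚ))) h0
    simp only [comp_assoc, add_comp, X_comp, C_comp, sub_add_cancel, comp_X, zero_comp] at this
    rw [Nat.sub_sub_self hle] at this
    exact hQ (trailingCoeff_eq_zero.mp this)
  · rw [← h (n + Q.natDegree) (by omega), coeff_weylOp]
    refine sum_of_injOn (fun j => (Q.natDegree - j, n + j)) ?_ ?_ ?_ ?_
    · intro i _ j _ hij
      simpa using congrArg Prod.snd hij
    · intro j hj
      simp only [coe_range, Set.mem_Iio, mem_coe, HasAntidiagonal.mem_antidiagonal] at hj ⊢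
      omega
    · rintro ⟨k, l⟩ hkl hnot
      rw [HasAntidiagonal.mem_antidiagonal] at hkl
      simp only at hkl
      suffices Q.coeff k = 0 by simp [this]
      by_contra hk
      have h1 := le_natDegree_of_ne_zero hk
      have h2 := natTrailingDegree_le_of_ne_zero hk
      refine hnot ⟨Q.natDegree - k, ?_, ?_⟩
      · simp only [coe_range, Set.mem_Iio]
        omega
      · simp only [Prod.mk.injEq]
        omega
    · intro j _
      simp

/-- A sequence of polynomials in `t` whose generating function is a rational function `N / D` with
`D(0) = 1`. -/
def IsRationalSeq (P : ℕ → ℚ[X]) : Prop :=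
  ∃ D N : ℚ[X][X], D.coeff 0 = 1 ∧ (D : PowerSeries ℚ[X]) * PowerSeries.mk P = N

theorem IsRationalSeq.isPRecursive {P : ℕ → ℚ[X]} (h : IsRationalSeq P) :
    IsPRecursive fun n => factorialFunctional (P n) := by
  obtain ⟨D, N, hD1, hDN⟩ := h
  set F := PowerSeries.mk P with hF
  have hD0 : (D : PowerSeries ℚ[X]) ≠ 0 := by
    intro h0
    have := congrArg (PowerSeries.coeff 0) h0
    rw [Polynomial.coeff_coe, hD1, map_zero] at this
    exact one_ne_zero this
  obtain ⟨d₁, h₁⟩ := coe_mem_boxSubmodule D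
  obtain ⟨d₂, h₂⟩ := coe_mem_boxSubmodule N
  obtain ⟨Q, G, M, K, hQ, hrel, hbox⟩ := exists_derivSubOp_relation (F := F) hD0
    (boxSubmodule_mono (le_max_left d₁ d₂) h₁)
    (by rw [hDN]; exact boxSubmodule_mono (le_max_right d₁ d₂) h₂)
  set U := PowerSeries.mk fun n => factorialFunctional (P n) with hU
  let ev : ℚ[X] →+* ℚ := evalRingHom 0
  have hQU : weylOp Q U = PowerSeries.map ev G := by
    have e := congrArg (mapCoeff factorialFunctional) hrel
    rw [map_add, mapCoeff_weylOp, map_zero] at e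
    have e1 : mapCoeff factorialFunctional F = U := by
      ext n
      simp [hF, hU]
    have e2 : mapCoeff factorialFunctional (derivSubOp G) = -PowerSeries.map ev G := by
      ext n
      simp [derivSubOp, factorialFunctional_derivSub, ev]
    rw [e1, e2] at e
    exact add_neg_eq_zero.mp e
  -- The denominator of `G` at `t = 0`, nonzero because `D` has constant term `1` in `z`.
  let E : ℚ[X] := (D.map ev) ^ M
  have hE : E ≠ 0 := by
    refine pow_ne_zero _ fun h0 => ?_
    have := congrArg (fun q => q.coeff 0) h0
    simp [hD1, ev] at this
  have hEQ : (E : PowerSeries ℚ) * weylOp Q U =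
      PowerSeries.map ev ((D : PowerSeries ℚ[X]) ^ M * G) := by
    rw [hQU, map_mul, map_pow]
    congr 1
    simp only [E, Polynomial.coe_pow]
    congr 1
    ext n
    simp
  refine IsPRecursive.of_weylOp (Q := E.map C * Q) (n₀ := K + 1)
    (mul_ne_zero ((Polynomial.map_ne_zero_iff (C_injective)).mpr hE) hQ) fun n hn => ?_
  rw [← coe_mul_weylOp, hEQ, PowerSeries.coeff_map]
  have : PowerSeries.coeff n ((D : PowerSeries ℚ[X]) ^ M * G) = 0 := by
    ext j
    rw [coeff_zero]
    exact hbox n j (by omega)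
  rw [this, map_zero]

theorem IsRationalSeq.add {P P' : ℕ → ℚ[X]} (h : IsRationalSeq P) (h' : IsRationalSeq P') :
    IsRationalSeq fun n => P n + P' n := by
  obtain ⟨D, N, h1, h2⟩ := h
  obtain ⟨D', N', h1', h2'⟩ := h'
  refine ⟨D * D', N * D' + N' * D, by rw [mul_coeff_zero, h1, h1', one_mul], ?_⟩
  have : PowerSeries.mk (fun n => P n + P' n) = PowerSeries.mk P + PowerSeries.mk P' := by
    ext1 n; simp
  rw [this, Polynomial.coe_mul, Polynomial.coe_add, Polynomial.coe_mul, Polynomial.coe_mul,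
    ← h2, ← h2']
  ring

theorem IsRationalSeq.const_mul {P : ℕ → ℚ[X]} (h : IsRationalSeq P) (a : ℚ[X]) :
    IsRationalSeq fun n => a * P n := by
  obtain ⟨D, N, h1, h2⟩ := h
  refine ⟨D, C a * N, h1, ?_⟩
  have : PowerSeries.mk (fun n => a * P n) = PowerSeries.C a * PowerSeries.mk P := by
    ext1 n; simp
  rw [this, Polynomial.coe_mul, ← h2, Polynomial.coe_C]
  ring

theorem IsRationalSeq.zero : IsRationalSeq fun _ => 0 :=
  ⟨1, 0, by simp, by ext1 n; simp⟩

theorem IsRationalSeq.sum {ι : Type*} (s : Finset ι) {P : ι → ℕ → ℚ[X]}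
    (h : ∀ i ∈ s, IsRationalSeq (P i)) : IsRationalSeq fun n => ∑ i ∈ s, P i n := by
  classical
  induction s using Finset.induction_on with
  | empty => simpa using IsRationalSeq.zero
  | insert a s ha ih =>
    simp_rw [sum_insert ha]
    exact (h a (mem_insert_self _ _)).add (ih fun i hi => h i (mem_insert_of_mem hi))

/-- Finite systems of linear recurrences have solutions with rational generating functions. -/
theorem isRationalSeq_of_transfer {σ : Type*} [Fintype σ] [DecidableEq σ] (T : Matrix σ σ ℚ[X])
    (P : ℕ → σ → ℚ[X]) (h : ∀ n, P (n + 1) = T.mulVec (P n)) (q : σ) :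
    IsRationalSeq fun n => P n q := by
  -- The system reads `(1 - zT) F = P 0`. Cramer's rule gives the denominator `det (1 - zT)`, which
  -- is `1` at `z = 0`.
  let A : Matrix σ σ ℚ[X][X] := 1 - (X : ℚ[X][X]) • T.map C
  let F : σ → PowerSeries ℚ[X] := fun q => PowerSeries.mk fun n => P n q
  let φ : ℚ[X][X] →+* PowerSeries ℚ[X] := Polynomial.coeToPowerSeries.ringHom
  have hA : (A.map φ).mulVec F = fun q => φ (C (P 0 q)) := by
    funext q
    ext1 n
    have e1 : (A.map φ).mulVec F q =
        F q - PowerSeries.X * ∑ q', PowerSeries.C (T q q') * F q' := by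
      simp only [Matrix.mulVec, dotProduct, A, Matrix.map_apply, Matrix.sub_apply,
        Matrix.smul_apply, smul_eq_mul, map_sub, map_mul, sub_mul, sum_sub_distrib, φ,
        Polynomial.coeToPowerSeries.ringHom_apply, Polynomial.coe_X, Polynomial.coe_C, mul_sum,
        mul_assoc]
      congr 1
      rw [sum_eq_single q]
      · simp
      · intro b _ hb
        simp [Matrix.one_apply_ne hb.symm]
      · simp
    rw [e1]
    simp only [φ, Polynomial.coeToPowerSeries.ringHom_apply, Polynomial.coe_C, map_sub]
    cases n with
    | zero => simp [F]
    | succ n =>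
      rw [PowerSeries.coeff_succ_X_mul, map_sum]
      simp [F, h n, Matrix.mulVec, dotProduct]
  refine ⟨A.det, A.adjugate.mulVec (fun q => C (P 0 q)) q, ?_, ?_⟩
  · rw [coeff_zero_eq_eval_zero, ← coe_evalRingHom, RingHom.map_det]
    have : (evalRingHom (0 : ℚ[X])).mapMatrix A = 1 := by
      ext1 i j
      by_cases hij : i = j
      · subst hij
        simp [A]
      · simp [A, Matrix.one_apply_ne hij]
    rw [this, Matrix.det_one]
  · have e := congrArg ((A.adjugate.map φ).mulVec) hA
    rw [Matrix.mulVec_mulVec, ← Matrix.map_mul, Matrix.adjugate_mul] at e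
    have e' := congrFun e q
    have l : ((A.det • (1 : Matrix σ σ ℚ[X][X])).map φ).mulVec F q = φ A.det * F q := by
      simp only [Matrix.mulVec, dotProduct, Matrix.map_apply, Matrix.smul_apply, smul_eq_mul,
        map_mul]
      rw [sum_eq_single q]
      · simp
      · intro b _ hb
        simp [Matrix.one_apply_ne hb.symm]
      · simp
    have r : (A.adjugate.map φ).mulVec (fun q => φ (C (P 0 q))) q =
        φ (A.adjugate.mulVec (fun q => C (P 0 q)) q) := by
      simp [Matrix.mulVec, dotProduct]
    rw [l, r] at e'
    exact e'

end HolonomyMain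

/-! ### Transfer matrix for rook placements in a band -/

section Transfer

open Polynomial Finset

/-- The signed placement polynomial: process `r` further rows, starting at row `k`, where `U` is
the set of columns already occupied. A row is either left free (factor `X`) or gets a rook in a
column `k + s ∉ U` with `s ∈ S` (factor `-1`). The final set of occupied columns is weighted
by `φ`. -/
noncomputable def placementPoly (S : Finset ℤ) (φ : Finset ℤ → ℚ[X]) :
    ℕ → ℤ → Finset ℤ → ℚ[X]
  | 0, _, U => φ U
  | r + 1, k, U => X * placementPoly S φ r (k + 1) U -
      ∑ s ∈ S with k + s ∉ U, placementPoly S φ r (k + 1) (insert (k + s) U)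

/-- Move the window of occupied columns one row down and truncate it to `[-m, m]`. -/
noncomputable def shiftWindow (m : ℕ) (U : Finset ℤ) : Finset ℤ :=
  (Icc (-(m : ℤ)) m).filter fun z => z + 1 ∈ U

/-- The placement polynomial in coordinates relative to the current row; the final window has to
avoid `Z`. -/
noncomputable def windowPoly (S : Finset ℤ) (m : ℕ) (Z : Finset ℤ) : ℕ → Finset ℤ → ℚ[X]
  | 0, U => if Disjoint Z U then 1 else 0
  | r + 1, U => X * windowPoly S m Z r (shiftWindow m U) -
      ∑ s ∈ S with s ∉ U, windowPoly S m Z r (shiftWindow m (insert s U))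

theorem shiftWindow_mem (m : ℕ) (U : Finset ℤ) :
    shiftWindow m U ∈ (Icc (-(m : ℤ)) m).powerset :=
  mem_powerset.mpr (filter_subset _ _)

theorem isRationalSeq_windowPoly (S : Finset ℤ) (m : ℕ) (Z : Finset ℤ) {U : Finset ℤ}
    (hU : U ∈ (Icc (-(m : ℤ)) m).powerset) : IsRationalSeq fun r => windowPoly S m Z r U := by
  let σ := {U : Finset ℤ // U ∈ (Icc (-(m : ℤ)) m).powerset}
  let sh : Finset ℤ → σ := fun U => ⟨shiftWindow m U, shiftWindow_mem m U⟩
  let T : Matrix σ σ ℚ[X] := fun q q' => (if q' = sh q.1 then X else 0) -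
    ∑ s ∈ S with s ∉ q.1, if q' = sh (insert s q.1) then 1 else 0
  refine isRationalSeq_of_transfer T (fun r q => windowPoly S m Z r q.1) (fun r => ?_) ⟨U, hU⟩
  funext q
  simp only [Matrix.mulVec, dotProduct, T, sub_mul, sum_sub_distrib, sum_mul, ite_mul, one_mul,
    zero_mul]
  rw [sum_comm]
  simp only [sum_ite_eq', mem_univ, if_true, sh]
  rw [windowPoly]

/-- Columns more than `m` behind the current row can never be used again, so `U`, the part of `V`
within distance `m` of row `k`, suffices. The condition on `φ` says that, on the final sets still
reachable from `V`, the weight is a constant times a test on columns near the end. -/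
theorem placementPoly_eq_windowPoly {S : Finset ℤ} {m : ℕ} (hS : ∀ s ∈ S, -(m : ℤ) ≤ s ∧ s < m)
    {Z : Finset ℤ} (hZ : ∀ z ∈ Z, -(m : ℤ) ≤ z) {φ : Finset ℤ → ℚ[X]} {a : ℚ[X]} (r : ℕ) :
    ∀ (k : ℤ) (U V : Finset ℤ), U ⊆ Icc (-(m : ℤ)) m →
      (∀ z, -(m : ℤ) ≤ z → (z ∈ U ↔ k + z ∈ V)) →
      (∀ W, V ⊆ W → (∀ c ∈ W, c ∈ V ∨ (k - m ≤ c ∧ c < k + r + m)) →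
        φ W = a * if ∀ z ∈ Z, k + r + z ∉ W then 1 else 0) →
      placementPoly S φ r k V = a * windowPoly S m Z r U := by
  induction r with
  | zero =>
    intro k U V hU hUV hφ
    rw [placementPoly, windowPoly, hφ V subset_rfl fun c hc => Or.inl hc]
    congr 1
    refine if_congr ?_ rfl rfl
    rw [disjoint_left]
    refine forall₂_congr fun z hz => ?_
    rw [hUV z (hZ z hz)]
    simp
  | succ r ih =>
    intro k U V hU hUV hφ
    have hsh : ∀ (U' V' : Finset ℤ), (∀ z, -(m : ℤ) ≤ z → (z ∈ U' ↔ k + z ∈ V')) →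
        U' ⊆ Icc (-(m : ℤ)) m → ∀ z, -(m : ℤ) ≤ z → (z ∈ shiftWindow m U' ↔ k + 1 + z ∈ V') := by
      intro U' V' h h' z hz
      have e : k + 1 + z = k + (z + 1) := by ring
      rw [e, ← h (z + 1) (by omega), shiftWindow, mem_filter, mem_Icc]
      refine ⟨fun h => h.2, fun hmem => ⟨⟨hz, ?_⟩, hmem⟩⟩
      have := mem_Icc.mp (h' hmem)
      omega
    have hfree := ih (k + 1) (shiftWindow m U) V (filter_subset _ _) (hsh U V hUV hU)
      (fun W hVW hW => by
        rw [hφ W hVW fun c hc => (hW c hc).imp_right fun h => by push_cast; omega]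
        push_cast
        simp only [add_assoc, add_comm (1 : ℤ)])
    rw [placementPoly, windowPoly, hfree, mul_sub, mul_sum]
    congr 1
    · ring
    · refine sum_congr ?_ ?_
      · ext s
        simp only [mem_filter]
        refine and_congr_right fun hs => ?_
        rw [hUV s (hS s hs).1]
      · intro s hs
        have hsS := hS s (mem_filter.mp hs).1
        have hins : ∀ z, -(m : ℤ) ≤ z → (z ∈ insert s U ↔ k + z ∈ insert (k + s) V) := by
          intro z hz
          rw [mem_insert, mem_insert, hUV z hz, add_right_inj]
        refine ih (k + 1) _ _ (filter_subset _ _) (hsh _ _ hins ?_) (fun W hVW hW => ?_)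
        · refine insert_subset (mem_Icc.mpr ?_) hU
          omega
        · rw [hφ W ((subset_insert _ _).trans hVW) fun c hc => ?_]
          · push_cast
            simp only [add_assoc, add_comm (1 : ℤ)]
          · rcases hW c hc with h | h
            · rcases mem_insert.mp h with h | h
              · right
                push_cast
                omega
              · exact Or.inl h
            · right
              push_cast
              omega

/-- If the final weight depends, for given occupied columns `V` after `2m` rows, only on the
columns at bounded distance from the end, then the placement polynomials have a rational
generating function. -/
theorem isRationalSeq_placementPoly {S : Finset ℤ} {m : ℕ} (hS : ∀ s ∈ S, -(m : ℤ) ≤ s ∧ s < m)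
    {φ : ℕ → Finset ℤ → ℚ[X]}
    (hφ : ∀ V ⊆ Ico (-(m : ℤ)) (3 * m), ∃ (Z : Finset ℤ) (a : ℚ[X]), (∀ z ∈ Z, -(m : ℤ) ≤ z) ∧
      ∀ (r : ℕ) (W : Finset ℤ), V ⊆ W → (∀ c ∈ W, c ∈ V ∨ ((m : ℤ) ≤ c ∧ c < r + 3 * m)) →
        φ (r + 2 * m) W = a * if ∀ z ∈ Z, 2 * (m : ℤ) + r + z ∉ W then 1 else 0) :
    IsRationalSeq fun r => placementPoly S (φ (r + 2 * m)) (r + 2 * m) 0 ∅ := by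
  -- The first `2m` rows are expanded outright, into finitely many cases `V`. All later rows reach
  -- only columns at least `m`, so `V` settles what happens in `[-m, m)`.
  have key : ∀ (j k : ℕ), k + j = 2 * m → ∀ V ⊆ Ico (-(m : ℤ)) (k + m),
      IsRationalSeq fun r => placementPoly S (φ (r + 2 * m)) (r + j) k V := by
    intro j
    induction j with
    | zero =>
      intro k hk V hV
      have hk' : (k : ℤ) = 2 * m := by omega
      obtain ⟨Z, a, hZ, h⟩ := hφ V (hV.trans (Ico_subset_Ico_right (by omega)))
      have hrat := (isRationalSeq_windowPoly S m Z
        (U := (Icc (-(m : ℤ)) m).filter fun z => k + z ∈ V)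
        (mem_powerset.mpr (filter_subset _ _))).const_mul a
      convert hrat using 2 with r
      refine placementPoly_eq_windowPoly hS hZ r k _ V (filter_subset _ _) ?_ ?_
      · intro z hz
        rw [mem_filter, mem_Icc]
        refine ⟨fun h => h.2, fun h => ⟨⟨hz, ?_⟩, h⟩⟩
        have := mem_Ico.mp (hV h)
        omega
      · intro W hVW hW
        rw [h r W hVW fun c hc => (hW c hc).imp_right fun h => by omega, hk']
    | succ j ih =>
      intro k hk V hV
      have h1 := ih (k + 1) (by omega) V (hV.trans (Ico_subset_Ico_right (by omega)))
      have h2 : IsRationalSeq fun r => ∑ s ∈ S with (k : ℤ) + s ∉ V,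
          placementPoly S (φ (r + 2 * m)) (r + j) (k + 1 : ℕ) (insert (k + s) V) := by
        refine IsRationalSeq.sum _ fun s hs => ih (k + 1) (by omega) _ ?_
        have hsS := hS s (mem_filter.mp hs).1
        refine insert_subset (mem_Ico.mpr ?_) (hV.trans (Ico_subset_Ico_right (by omega)))
        omega
      convert (h1.const_mul X).add (h2.const_mul (-1)) using 2 with r
      rw [← add_assoc, placementPoly]
      push_cast
      ring
  exact key (2 * m) 0 (by omega) ∅ (empty_subset _)

end Transfer

/-! ### Inclusion–exclusion for permutations, and the two counts -/

section Counting

open Polynomial Finset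

/-- Composing with the inverse of a permutation that extends `f` reduces to permutations fixing `A`
pointwise. -/
theorem card_perm_eq_on {α : Type*} [Fintype α] [DecidableEq α] {A : Finset α} {f : α → α}
    (hf : Set.InjOn f A) :
    (univ.filter fun σ : Equiv.Perm α => ∀ i ∈ A, σ i = f i).card =
      (Fintype.card α - A.card).factorial := by
  obtain ⟨g, hg⟩ := exists_equiv_extend_of_card_eq (α := α) (t := univ) card_univ.symm
    (subset_univ (A.image f)) hf
  let τ : Equiv.Perm α := g.trans (Equiv.subtypeUnivEquiv mem_univ)
  have hτ : ∀ i ∈ A, τ i = f i := hg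
  have e : {σ : Equiv.Perm α // ∀ i ∈ A, σ i = f i} ≃
      {ρ : Equiv.Perm α // ∀ i, ¬ i ∉ A → ρ i = i} :=
    (Equiv.mulLeft τ⁻¹).subtypeEquiv fun σ => by
      refine forall_congr' fun i => ?_
      rw [not_not]
      refine forall_congr' fun hi => ?_
      rw [Equiv.coe_mulLeft, Equiv.Perm.mul_apply, Equiv.Perm.inv_eq_iff_eq, hτ i hi]
  rw [← Fintype.card_subtype, Fintype.card_congr e,
    ← Fintype.card_congr (Equiv.Perm.subtypeEquivSubtypePerm fun i => i ∉ A), Fintype.card_perm,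
    Fintype.card_subtype_compl, Fintype.card_coe]

open Classical in
/-- The weight of a set `U` of integers, to be realised by columns: `1` if every member of `U`
represents a column and different members represent different columns, and `0` otherwise. -/
noncomputable def columnWeight {n : ℕ} (E : ℤ → Fin n → Prop) (U : Finset ℤ) : ℚ[X] :=
  if (∀ c ∈ U, ∃ j, E c j) ∧ ∀ c ∈ U, ∀ c' ∈ U, ∀ j, E c j → E c' j → c = c' then 1 else 0

theorem columnWeight_eq_ite {n : ℕ} {E : ℤ → Fin n → Prop} {U : Finset ℤ} {p : Prop} [Decidable p]
    (h : ((∀ c ∈ U, ∃ j, E c j) ∧ ∀ c ∈ U, ∀ c' ∈ U, ∀ j, E c j → E c' j → c = c') ↔ p) :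
    columnWeight E U = if p then 1 else 0 := by
  rw [columnWeight]
  by_cases hp : p
  · rw [if_pos hp, if_pos (h.mpr hp)]
  · rw [if_neg hp, if_neg (mt h.mp hp)]

open Classical in
theorem card_perm_partial {n : ℕ} {E : ℤ → Fin n → Prop}
    (hE : ∀ c j j', E c j → E c j' → j = j') {A : Finset (Fin n)} {c : Fin n → ℤ}
    (hc : Set.InjOn c A) :
    ((univ.filter fun σ : Equiv.Perm (Fin n) => ∀ i ∈ A, E (c i) (σ i)).card : ℚ) =
      factorialFunctional (X ^ (n - A.card) * columnWeight E (A.image c)) := by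
  rw [columnWeight]
  split_ifs with h
  · obtain ⟨h1, h2⟩ := h
    have h3 : ∀ i, ∃ j, i ∈ A → E (c i) j := fun i => by
      by_cases hi : i ∈ A
      · obtain ⟨j, hj⟩ := h1 (c i) (mem_image_of_mem c hi)
        exact ⟨j, fun _ => hj⟩
      · exact ⟨i, fun h => absurd h hi⟩
    choose f hf using h3
    have hinj : Set.InjOn f A := by
      intro i hi i' hi' hii
      refine hc hi hi' (h2 _ (mem_image_of_mem c hi) _ (mem_image_of_mem c hi') (f i)
        (hf i hi) ?_)
      rw [hii]
      exact hf i' hi'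
    rw [mul_one, factorialFunctional_X_pow]
    have := card_perm_eq_on hinj
    rw [Fintype.card_fin] at this
    rw [← this]
    congr 2
    ext σ
    simp only [mem_filter, mem_univ, true_and]
    refine forall₂_congr fun i hi => ⟨fun h => hE _ _ _ h (hf i hi), fun h => ?_⟩
    rw [h]
    exact hf i hi
  · rw [mul_zero, map_zero, Nat.cast_eq_zero, card_eq_zero, filter_eq_empty_iff]
    intro σ _ hσ
    refine h ⟨fun x hx => ?_, fun x hx y hy j hxj hyj => ?_⟩
    · obtain ⟨i, hi, rfl⟩ := mem_image.mp hx
      exact ⟨_, hσ i hi⟩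
    · obtain ⟨i, hi, rfl⟩ := mem_image.mp hx
      obtain ⟨i', hi', rfl⟩ := mem_image.mp hy
      have e1 := hE _ _ _ (hσ i hi) hxj
      have e2 := hE _ _ _ (hσ i' hi') hyj
      rw [σ.injective (e1.trans e2.symm)]

theorem ite_and_forall_not_eq_sub {S : Finset ℤ} (P Q : Prop) {R : ℤ → Prop}
    (hR : ∀ s ∈ S, ∀ s' ∈ S, R s → R s' → s = s') [Decidable (P ∧ (∀ s ∈ S, ¬ R s) ∧ Q)]
    [Decidable (P ∧ Q)] [∀ s, Decidable ((R s ∧ P) ∧ Q)] :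
    ((if P ∧ (∀ s ∈ S, ¬ R s) ∧ Q then 1 else 0 : ℕ) : ℚ) =
      (if P ∧ Q then 1 else 0 : ℕ) - ∑ s ∈ S, ((if (R s ∧ P) ∧ Q then 1 else 0 : ℕ) : ℚ) := by
  by_cases hP : P
  swap
  · simp [hP]
  by_cases hQ : Q
  swap
  · simp [hQ]
  by_cases h : ∃ s ∈ S, R s
  · obtain ⟨s, hs, hRs⟩ := h
    rw [if_neg (fun h => h.2.1 s hs hRs), if_pos ⟨hP, hQ⟩, sum_eq_single s]
    · rw [if_pos ⟨⟨hRs, hP⟩, hQ⟩]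
      simp
    · intro s' hs' hne
      rw [if_neg fun h => hne (hR _ hs' _ hs h.1.1 hRs), Nat.cast_zero]
    · exact fun h => absurd hs h
  · push Not at h
    rw [if_pos ⟨hP, h, hQ⟩, if_pos ⟨hP, hQ⟩,
      sum_eq_zero fun s hs => by rw [if_neg fun h' => h s hs h'.1.1, Nat.cast_zero], sub_zero]

open Classical in
-- Inclusion–exclusion one row at a time: row `k` is either unconstrained, or forced into a
-- forbidden column `k + s` with sign `-1`. Among the rows before `k`, those in `A` carry rooks and
-- the other `k - A.card` are free, whence the power of `X`.
theorem card_eq_factorialFunctional {n : ℕ} {E : ℤ → Fin n → Prop} {S : Finset ℤ}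
    (hE : ∀ c j j', E c j → E c j' → j = j')
    (hS : ∀ (i : ℤ) (j : Fin n), ∀ s ∈ S, ∀ s' ∈ S, E (i + s) j → E (i + s') j → s = s') (r : ℕ) :
    ∀ (k : ℕ) (A : Finset (Fin n)) (c : Fin n → ℤ), k + r = n → (∀ i ∈ A, (i : ℕ) < k) →
      Set.InjOn c A →
      ((univ.filter fun σ : Equiv.Perm (Fin n) => (∀ i ∈ A, E (c i) (σ i)) ∧
        ∀ i : Fin n, k ≤ i → ∀ s ∈ S, ¬ E (((i : ℕ) : ℤ) + s) (σ i)).card : ℚ) =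
      factorialFunctional
        (X ^ (k - A.card) * placementPoly S (columnWeight E) r k (A.image c)) := by
  induction r with
  | zero =>
    intro k A c hk hA hc
    obtain rfl : k = n := hk
    rw [placementPoly, ← card_perm_partial hE hc]
    congr 2
    ext σ
    simp only [mem_filter, mem_univ, true_and, and_iff_left_iff_imp]
    intro _ i hi
    omega
  | succ r ih =>
    intro k A c hk hA hc
    have hkn : k < n := by omega
    set i₀ : Fin n := ⟨k, hkn⟩ with hi₀
    have hi₀A : i₀ ∉ A := fun h => lt_irrefl k (hA i₀ h)
    have hcard : A.card ≤ k := by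
      have : A ⊆ univ.filter fun i : Fin n => (i : ℕ) < k := fun i hi => by simp [hA i hi]
      refine (card_le_card this).trans ?_
      rw [Fin.card_filter_val_lt]
      exact min_le_right _ _
    have himage : ∀ x, (insert i₀ A).image (Function.update c i₀ x) = insert x (A.image c) := by
      intro x
      rw [image_insert, Function.update_self]
      congr 1
      refine image_congr fun i hi => ?_
      rw [Function.update_of_ne]
      rintro rfl
      exact hi₀A hi
    have hupd : ∀ (x : ℤ) (σ : Equiv.Perm (Fin n)),
        (∀ i ∈ insert i₀ A, E (Function.update c i₀ x i) (σ i)) ↔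
          E x (σ i₀) ∧ ∀ i ∈ A, E (c i) (σ i) := by
      intro x σ
      rw [forall_mem_insert, Function.update_self]
      refine and_congr_right fun _ => forall₂_congr fun i hi => ?_
      rw [Function.update_of_ne]
      rintro rfl
      exact hi₀A hi
    have hsplit : ∀ σ : Equiv.Perm (Fin n),
        (∀ i : Fin n, k ≤ i → ∀ s ∈ S, ¬ E (((i : ℕ) : ℤ) + s) (σ i)) ↔
          (∀ s ∈ S, ¬ E ((k : ℤ) + s) (σ i₀)) ∧
          ∀ i : Fin n, k + 1 ≤ i → ∀ s ∈ S, ¬ E (((i : ℕ) : ℤ) + s) (σ i) := by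
      intro σ
      refine ⟨fun h => ⟨h i₀ le_rfl, fun i hi => h i (by omega)⟩, fun h i hi => ?_⟩
      rcases Nat.eq_or_lt_of_le hi with hi | hi
      · obtain rfl : i₀ = i := Fin.ext hi
        exact h.1
      · exact h.2 i hi
    have hrec : ((univ.filter fun σ : Equiv.Perm (Fin n) => (∀ i ∈ A, E (c i) (σ i)) ∧
        ∀ i : Fin n, k ≤ i → ∀ s ∈ S, ¬ E (((i : ℕ) : ℤ) + s) (σ i)).card : ℚ) =
        (univ.filter fun σ : Equiv.Perm (Fin n) => (∀ i ∈ A, E (c i) (σ i)) ∧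
          ∀ i : Fin n, k + 1 ≤ i → ∀ s ∈ S, ¬ E (((i : ℕ) : ℤ) + s) (σ i)).card -
        ∑ s ∈ S, ((univ.filter fun σ : Equiv.Perm (Fin n) =>
          (∀ i ∈ insert i₀ A, E (Function.update c i₀ ((k : ℤ) + s) i) (σ i)) ∧
          ∀ i : Fin n, k + 1 ≤ i → ∀ s ∈ S, ¬ E (((i : ℕ) : ℤ) + s) (σ i)).card : ℚ) := by
      simp only [card_filter, Nat.cast_sum, hupd, hsplit]
      rw [sum_comm, ← sum_sub_distrib]
      refine sum_congr rfl fun σ _ => ?_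
      exact ite_and_forall_not_eq_sub _ _ fun s hs s' hs' => hS _ _ s hs s' hs'
    rw [hrec, ih (k + 1) A c (by omega) (fun i hi => (hA i hi).trans (Nat.lt_succ_self k)) hc,
      placementPoly, mul_sub, map_sub, mul_sum, map_sum]
    congr 1
    · rw [Nat.succ_sub hcard, pow_succ, mul_assoc]
      push_cast
      rfl
    · rw [sum_filter]
      refine sum_congr rfl fun s hs => ?_
      by_cases hmem : (k : ℤ) + s ∉ A.image c
      · rw [if_pos hmem, ih (k + 1) (insert i₀ A) (Function.update c i₀ (k + s)) (by omega), himage,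
          card_insert_of_notMem hi₀A, Nat.add_sub_add_right]
        · push_cast
          rfl
        · intro i hi
          rcases mem_insert.mp hi with rfl | hi
          · exact Nat.lt_succ_self k
          · exact (hA i hi).trans (Nat.lt_succ_self k)
        · rw [coe_insert, Set.injOn_insert (by simpa using hi₀A)]
          have hup : ∀ i ∈ A, Function.update c i₀ ((k : ℤ) + s) i = c i := fun i hi => by
            rw [Function.update_of_ne]
            rintro rfl
            exact hi₀A hi
          refine ⟨fun i hi j hj hij => ?_, ?_⟩
          · rw [hup i hi, hup j hj] at hij
            exact hc hi hj hij
          · rintro ⟨i, hi, h⟩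
            rw [hup i hi, Function.update_self] at h
            exact hmem (mem_image.mpr ⟨i, hi, h⟩)
      -- An occupied column would give two rows the same image, so such terms vanish, in agreement
      -- with the filter in `placementPoly`.
      · rw [if_neg hmem, Nat.cast_eq_zero, card_eq_zero, filter_eq_empty_iff]
        rintro σ _ ⟨h, _⟩
        rw [hupd] at h
        rw [not_not] at hmem
        obtain ⟨i, hi, hci⟩ := mem_image.mp hmem
        have h' := h.2 i hi
        rw [hci] at h'
        have : i₀ = i := σ.injective (hE _ _ _ h.1 h')
        exact hi₀A (this ▸ hi)

open Classical in
theorem card_perm_avoiding {n : ℕ} {E : ℤ → Fin n → Prop} {S : Finset ℤ}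
    (hE : ∀ c j j', E c j → E c j' → j = j')
    (hS : ∀ (i : ℤ) (j : Fin n), ∀ s ∈ S, ∀ s' ∈ S, E (i + s) j → E (i + s') j → s = s') :
    ((univ.filter fun σ : Equiv.Perm (Fin n) =>
        ∀ i : Fin n, ∀ s ∈ S, ¬ E (((i : ℕ) : ℤ) + s) (σ i)).card : ℚ) =
      factorialFunctional (placementPoly S (columnWeight E) n 0 ∅) := by
  have := card_eq_factorialFunctional hE hS n 0 ∅ (fun _ => 0) (by omega) (by simp) (by simp)
  simpa using this

theorem exists_window (S : Finset ℤ) :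
    ∃ m : ℕ, 0 < m ∧ ∀ s ∈ S, -(m : ℤ) ≤ s ∧ s < m := by
  refine ⟨S.sup Int.natAbs + 1, by omega, fun s hs => ?_⟩
  have := le_sup (f := Int.natAbs) hs
  omega

theorem isPRecursive_straightCount (S : Finset ℤ) :
    IsPRecursive fun n => (straightCount S n : ℚ) := by
  classical
  obtain ⟨m, hm, hS⟩ := exists_window S
  refine IsPRecursive.of_shift (2 * m) ?_
  let E : (n : ℕ) → ℤ → Fin n → Prop := fun n c j => ((j : ℕ) : ℤ) = c
  have hcount : ∀ n, (straightCount S n : ℚ) =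
      factorialFunctional (placementPoly S (columnWeight (E n)) n 0 ∅) := by
    intro n
    rw [← card_perm_avoiding, straightCount]
    · congr 2
      ext σ
      simp only [mem_filter, mem_univ, true_and, E]
      refine forall_congr' fun i => ⟨fun h s hs e => h ?_, fun h hs => h _ hs ?_⟩
      · rwa [e, add_sub_cancel_left]
      · ring
    · exact fun c j j' h h' => Fin.ext (by simp only [E] at h h'; omega)
    · intro i j s _ s' _ h h'
      simp only [E] at h h'
      omega
  simp_rw [hcount]
  refine IsRationalSeq.isPRecursive (isRationalSeq_placementPoly hS
    (φ := fun n => columnWeight (E n)) fun V hV => ?_)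
  -- Rooks must stay on the board: overflow on the left is visible in `V`, overflow on the right
  -- means a column `n + z` with `0 ≤ z < m`.
  refine ⟨Ico 0 (m : ℤ), if ∀ c ∈ V, 0 ≤ c then 1 else 0, fun z hz => ?_, fun r W hVW hW => ?_⟩
  · rw [mem_Ico] at hz
    omega
  · rw [ite_mul, one_mul, zero_mul, ← ite_and]
    refine columnWeight_eq_ite ⟨fun h => ⟨fun c hc => ?_, fun z hz hzW => ?_⟩,
      fun h => ⟨fun c hc => ?_, ?_⟩⟩
    · obtain ⟨j, hj⟩ := h.1 c (hVW hc)
      simp only [E] at hj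
      omega
    · obtain ⟨j, hj⟩ := h.1 _ hzW
      simp only [E] at hj
      rw [mem_Ico] at hz
      omega
    · have h0 : 0 ≤ c := by
        rcases hW c hc with h' | h'
        · exact h.1 c h'
        · omega
      have h1 : c < r + 3 * m := by
        rcases hW c hc with h' | h'
        · have := mem_Ico.mp (hV h')
          omega
        · omega
      have h2 : c < r + 2 * m := by
        by_contra h3
        refine h.2 (c - (2 * m + r)) (mem_Ico.mpr (by omega)) ?_
        rwa [add_sub_cancel]
      refine ⟨⟨c.toNat, by omega⟩, ?_⟩
      simp only [E]
      omega
    · intro c _ c' _ j h h'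
      exact h.symm.trans h'

theorem isPRecursive_circularCount (S : Finset ℤ) :
    IsPRecursive fun n => (circularCount S n : ℚ) := by
  classical
  obtain ⟨m, hm, hS⟩ := exists_window S
  refine IsPRecursive.of_shift (2 * m) ?_
  let E : (n : ℕ) → ℤ → Fin n → Prop := fun n c j => ((j : ℕ) : ℤ) ≡ c [ZMOD (n : ℤ)]
  have hcount : ∀ r : ℕ, (circularCount S (r + 2 * m) : ℚ) = factorialFunctional
      (placementPoly S (columnWeight (E (r + 2 * m))) (r + 2 * m) 0 ∅) := by
    intro r
    rw [← card_perm_avoiding, circularCount]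
    · congr 2
      ext σ
      simp only [mem_filter, mem_univ, true_and, E]
      refine forall_congr' fun i => forall₂_congr fun s _ => not_congr ?_
      rw [Int.modEq_iff_dvd, Int.modEq_iff_dvd]
      ring_nf
    · intro c j j' h h'
      have := h.trans h'.symm
      rw [Int.natCast_modEq_iff] at this
      exact Fin.ext (Nat.ModEq.eq_of_lt_of_lt this j.2 j'.2)
    · intro i j s hs s' hs' h h'
      have h1 := Int.modEq_iff_dvd.mp (h.symm.trans h')
      have h2 := hS s hs
      have h3 := hS s' hs'
      -- Here `n ≥ 2m` matters: distinct members of `S` stay distinct modulo `n`.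
      have h4 := Int.eq_zero_of_abs_lt_dvd h1 (by rw [abs_lt]; push_cast; omega)
      omega
  simp_rw [hcount]
  refine IsRationalSeq.isPRecursive (isRationalSeq_placementPoly hS
    (φ := fun n => columnWeight (E n)) fun V hV => ?_)
  -- On the circle every column exists, and the only danger is a wrap-around clash between `c` and
  -- `c + n`, with `c` among the early columns recorded in `V`.
  refine ⟨V ∩ Ico (-(m : ℤ)) m, 1, fun z hz => ?_, fun r W hVW hW => ?_⟩
  · exact (mem_Ico.mp (mem_inter.mp hz).2).1
  -- All columns lie in `[-m, n + m)` and `2m ≤ n`, so congruent ones differ by less than `2n`,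
  -- hence by exactly `n`. The smaller is then below `m`, so it belongs to `V`.
  have hlt : ∀ c ∈ W, ∀ c' ∈ W, c < c' → c ≡ c' [ZMOD ((r + 2 * m : ℕ) : ℤ)] →
      c ∈ V ∩ Ico (-(m : ℤ)) m ∧ 2 * (m : ℤ) + r + c = c' := by
    intro c hc c' hc' hlt hmod
    have hcb : -(m : ℤ) ≤ c := by
      rcases hW c hc with h | h
      · exact (mem_Ico.mp (hV h)).1
      · omega
    have hcb' : c' < r + 3 * m := by
      rcases hW c' hc' with h | h
      · have := (mem_Ico.mp (hV h)).2
        omega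
      · omega
    have hdvd : ((r + 2 * m : ℕ) : ℤ) ∣ c' - c - (r + 2 * m : ℕ) :=
      dvd_sub_self_right.mpr (Int.modEq_iff_dvd.mp hmod)
    have hle := Int.le_of_dvd (by omega) (Int.modEq_iff_dvd.mp hmod)
    have heq := Int.eq_zero_of_abs_lt_dvd hdvd (by rw [abs_lt]; push_cast at hle ⊢; omega)
    push_cast at heq
    refine ⟨mem_inter.mpr ⟨?_, mem_Ico.mpr (by omega)⟩, by omega⟩
    rcases hW c hc with h | h
    · exact h
    · omega
  rw [one_mul]
  refine columnWeight_eq_ite ⟨fun h z hz hzW => ?_,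
    fun h => ⟨fun c _ => ?_, fun c hc c' hc' j hj hj' => ?_⟩⟩
  · have hpos : 0 < r + 2 * m := by omega
    obtain ⟨j, hj⟩ := h.1 z (hVW (mem_inter.mp hz).1)
    have : 2 * (m : ℤ) + r + z = z := by
      refine h.2 _ hzW _ (hVW (mem_inter.mp hz).1) j (hj.trans ?_) hj
      rw [Int.modEq_iff_dvd]
      exact ⟨1, by push_cast; ring⟩
    omega
  · have hpos : (0 : ℤ) < ((r + 2 * m : ℕ) : ℤ) := by omega
    have h1 := Int.emod_nonneg c hpos.ne'
    have h2 := Int.emod_lt_of_pos c hpos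
    refine ⟨⟨(c % ((r + 2 * m : ℕ) : ℤ)).toNat, by omega⟩, ?_⟩
    simp only [E]
    rw [Int.toNat_of_nonneg h1]
    exact Int.mod_modEq _ _
  · have hmod : c ≡ c' [ZMOD ((r + 2 * m : ℕ) : ℤ)] := hj.symm.trans hj'
    rcases lt_trichotomy c c' with hc1 | hc1 | hc1
    · obtain ⟨h1, h2⟩ := hlt c hc c' hc' hc1 hmod
      exact absurd (h2 ▸ hc') (h c h1)
    · exact hc1
    · obtain ⟨h1, h2⟩ := hlt c' hc' c hc hc1 hmod.symm
      exact absurd (h2 ▸ hc) (h c' h1)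

end Counting

theorem mainTheorem2 (S : Finset ℤ) :
    IsPRecursive (fun n => (straightCount S n : ℚ)) ∧
      IsPRecursive (fun n => (circularCount S n : ℚ)) :=
  ⟨isPRecursive_straightCount S, isPRecursive_circularCount S⟩
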